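/- Let $\exp(x)=2^x$ for real $x$ and, for an integer $N\geq 1$, let $\exp^N$ denote the $N$-fold composition of $\exp$ with itself. Given a group $G$ and an integer $k\geq 0$, a set $A\subseteq G$ is called $k$-stable if there do not exist $a_1,\ldots,a_k,b_1,\ldots,b_k\in G$ such that, for all $1\leq i,j\leq k$, $a_ib_j\in A$ if and only if $i\leq j$. Theorem. For every $k$ there is an integer $N=N(k)\geq 1$, depending only on $k$, such that the following holds. Suppose $G$ is a finite group and $A\subseteq G$ is $k$-stable. Then for any real $\epsilon>0$, there is a normal subgroup $H\leq G$ of index at most $\exp^{N}(\epsilon^{-1})$, and a set $D\subseteq G$ which is a (possibly empty) union of cosets of $H$, such that $|A\mathbin{\triangle}D|<\epsilon|H|$. -/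

import Mathlib

open scoped Pointwise symmDiff

/-- A subset `A` of a group is `k`-stable if there are no `a₁, …, a_k, b₁, …, b_k` in the group
such that, for all `i, j`, the product `a_i * b_j` lies in `A` if and only if `i ≤ j`. -/
def IsKStable {G : Type*} [Group G] (k : ℕ) (A : Set G) : Prop :=
  ¬ ∃ a b : Fin k → G, ∀ i j : Fin k, a i * b j ∈ A ↔ i ≤ j

/-- `iterExp n x` is `exp^n (x)`, the `n`-fold composition of the base-`2` exponential function
applied to `x`. -/
noncomputable def iterExp (n : ℕ) (x : ℝ) : ℝ :=
  (fun y : ℝ => (2 : ℝ) ^ y)^[n] x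

/-- `D` is a union of (left) cosets of `H`; the family of cosets may be empty. -/
def IsUnionOfCosets {G : Type*} [Group G] (H : Subgroup G) (D : Set G) : Prop :=
  ∃ S : Set G, D = ⋃ g ∈ S, g • (H : Set G)

/-! Stability bounds the height of binary trees for the relation `x * y ∈ A` by some `d`, since a
taller tree contains a half-graph. The function `shiftDist A` is a symmetric subadditive length on
`G`. If it took a value in each of `d` widely separated windows, the corresponding shifts would
build a tree of height `d` (`exists_splitTree_of_scales`). So some window is empty, and the elements
below it form a subgroup `H` (`exists_subgroup_of_gap`). The top of the window controls the index of
`H`, because separated translates also produce trees (`index_le_of_shiftDist_le`). The bottom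
controls how far `A` is from a union of cosets (`ncard_symmDiff_cosetMajority_le`). Windows with
iterated-exponential ratios make this error small even against the size of the normal core of `H`.
-/

/-- A full binary tree of height `n` for the relation `R`: nodes are labelled by points of `P`,
and each branch is realised by an element of `S`. -/
def SplitTree {X Y : Type*} (R : X → Y → Prop) : ℕ → Set X → Set Y → Prop
  | 0, _, S => S.Nonempty
  | n + 1, P, S => ∃ x ∈ P, SplitTree R n P {y ∈ S | R x y} ∧ SplitTree R n P {y ∈ S | ¬ R x y}

/-! ### Binary trees and half-graphs. -/

namespace SplitTree

variable {X Y : Type*} {R : X → Y → Prop}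

theorem mono {n : ℕ} : ∀ {P P' : Set X} {S S' : Set Y}, P ⊆ P' → S ⊆ S' →
    SplitTree R n P S → SplitTree R n P' S' := by
  induction n with
  | zero => intro P P' S S' _ hS h; exact Set.Nonempty.mono hS h
  | succ n ih =>
    rintro P P' S S' hP hS ⟨x, hx, h1, h2⟩
    exact ⟨x, hP hx, ih hP (fun y hy => ⟨hS hy.1, hy.2⟩) h1, ih hP (fun y hy => ⟨hS hy.1, hy.2⟩) h2⟩

theorem nonempty {n : ℕ} : ∀ {P : Set X} {S : Set Y}, SplitTree R n P S → S.Nonempty := by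
  induction n with
  | zero => intro P S h; exact h
  | succ n ih => rintro P S ⟨x, _, h, _⟩; exact (ih h).mono (fun y hy => hy.1)

/-- Ramsey property of trees: colouring the nodes with two colours leaves a tall tree in one of
the colours. -/
theorem ramsey (N : ℕ) : ∀ (m n : ℕ) {P P₁ P₂ : Set X} {S : Set Y}, m + n = N → P ⊆ P₁ ∪ P₂ →
    SplitTree R N P S → SplitTree R m P₁ S ∨ SplitTree R n P₂ S := by
  induction N with
  | zero =>
    intro m n P P₁ P₂ S h _ hS
    obtain rfl : m = 0 := by omega
    exact Or.inl hS
  | succ N ih =>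
    intro m n P P₁ P₂ S h hP hS
    have hne := hS.nonempty
    obtain ⟨x, hx, h1, h2⟩ := hS
    rcases m with _ | m
    · exact Or.inl hne
    rcases n with _ | n
    · exact Or.inr hne
    rcases hP hx with hx | hx
    -- The root has the first colour: it joins two subtrees of height `m` in that colour, unless one
    -- side already has a tree of full height `n + 1` in the other.
    · rcases ih m (n + 1) (by omega) hP h1 with a1 | a1
      · rcases ih m (n + 1) (by omega) hP h2 with a2 | a2
        · exact Or.inl ⟨x, hx, a1, a2⟩
        · exact Or.inr (a2.mono le_rfl (fun y hy => hy.1))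
      · exact Or.inr (a1.mono le_rfl (fun y hy => hy.1))
    · rcases ih (m + 1) n (by omega) hP h1 with a1 | a1
      · exact Or.inl (a1.mono le_rfl (fun y hy => hy.1))
      · rcases ih (m + 1) n (by omega) hP h2 with a2 | a2
        · exact Or.inl (a2.mono le_rfl (fun y hy => hy.1))
        · exact Or.inr ⟨x, hx, a1, a2⟩

end SplitTree

/-- A height of trees that forces a strict half-graph of size `m` or a half-graph of size `n`. -/
def ladderHeight : ℕ → ℕ → ℕ
  | 0, _ => 0
  | _, 0 => 0
  | m + 1, n + 1 => (ladderHeight (m + 1) n + 1) + (ladderHeight m (n + 1) + 1)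

/-- Fix a leaf `y`, colour the nodes by `R x y`, and apply `ramsey`. If the colour `R x y` wins,
recurse below its root `x` on the side `¬ R x ·` and append `(x, y)` to a non-strict half-graph. If
the other wins, recurse on the side `R x ·` and prepend `(x, y)` to a strict one. -/
theorem SplitTree.exists_ladder {X Y : Type*} [Nonempty X] [Nonempty Y] {R : X → Y → Prop} :
    ∀ (m n : ℕ) {P : Set X} {S : Set Y}, SplitTree R (ladderHeight m n) P S →
    (∃ (a : ℕ → X) (b : ℕ → Y), (∀ i < m, a i ∈ P ∧ b i ∈ S) ∧
      ∀ i < m, ∀ j < m, R (a i) (b j) ↔ i < j) ∨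
    (∃ (a : ℕ → X) (b : ℕ → Y), (∀ i < n, a i ∈ P ∧ b i ∈ S) ∧
      ∀ i < n, ∀ j < n, R (a i) (b j) ↔ i ≤ j) := by
  intro m
  induction m with
  | zero =>
    intro n P S _
    exact Or.inl ⟨fun _ => Classical.arbitrary X, fun _ => Classical.arbitrary Y,
      by simp, by simp⟩
  | succ m ihm =>
    intro n
    induction n with
    | zero =>
      intro P S _
      exact Or.inr ⟨fun _ => Classical.arbitrary X, fun _ => Classical.arbitrary Y,
        by simp, by simp⟩
    | succ n ihn =>
      intro P S h
      obtain ⟨y, hy⟩ := h.nonempty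
      have hP : P ⊆ {x ∈ P | R x y} ∪ {x ∈ P | ¬ R x y} := by
        intro x hx
        by_cases hxy : R x y
        · exact Or.inl ⟨hx, hxy⟩
        · exact Or.inr ⟨hx, hxy⟩
      rw [ladderHeight] at h
      rcases SplitTree.ramsey _ _ _ rfl hP h with ⟨x, hx, -, h'⟩ | ⟨x, hx, h', -⟩
      · rcases ihn h' with ⟨a, b, hab, hR⟩ | ⟨a, b, hab, hR⟩
        · exact Or.inl ⟨a, b, fun i hi => ⟨(hab i hi).1.1, (hab i hi).2.1⟩, hR⟩
        · refine Or.inr ⟨fun i => if i < n then a i else x, fun i => if i < n then b i else y,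
            fun i _ => ?_, fun i hi j hj => ?_⟩
          · by_cases hi : i < n
            · simpa [hi] using ⟨(hab i hi).1.1, (hab i hi).2.1⟩
            · simpa [hi] using ⟨hx.1, hy⟩
          · by_cases hi' : i < n <;> by_cases hj' : j < n
            · simpa [hi', hj'] using hR i hi' j hj'
            · have := (hab i hi').1.2
              simp only [hi', hj', if_true, if_false]
              exact ⟨fun _ => by omega, fun _ => this⟩
            · have := (hab j hj').2.2
              simp only [hi', hj', if_true, if_false]
              exact ⟨fun h => absurd h this, fun _ => by omega⟩
            · have := hx.2
              simp only [hi', hj', if_false]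
              exact ⟨fun _ => by omega, fun _ => this⟩
      · rcases ihm (n + 1) h' with ⟨a, b, hab, hR⟩ | ⟨a, b, hab, hR⟩
        · refine Or.inl ⟨fun i => Nat.casesOn i x a, fun i => Nat.casesOn i y b,
            fun i hi => ?_, fun i hi j hj => ?_⟩
          · rcases i with _ | i
            · exact ⟨hx.1, hy⟩
            · exact ⟨(hab i (by omega)).1.1, (hab i (by omega)).2.1⟩
          · rcases i with _ | i <;> rcases j with _ | j
            · simpa using hx.2
            · simpa using (hab j (by omega)).2.2
            · simpa using (hab i (by omega)).1.2
            · simpa using hR i (by omega) j (by omega)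
        · exact Or.inr ⟨a, b, fun i hi => ⟨(hab i hi).1.1, (hab i hi).2.1⟩, hR⟩

theorem IsKStable.not_splitTree {G : Type*} [Group G] {k : ℕ} {A : Set G} (hA : IsKStable k A) :
    ¬ SplitTree (fun x y : G => x * y ∈ A) (ladderHeight (k + 1) k) Set.univ Set.univ := by
  intro h
  rcases h.exists_ladder with ⟨a, b, -, hR⟩ | ⟨a, b, -, hR⟩
  -- Dropping `b 0` turns `i < j + 1` into `i ≤ j`; this is why the strict half-graph needs size `k
  -- + 1`.
  · refine hA ⟨fun i => a i, fun j => b (j + 1), fun i j => ?_⟩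
    rw [hR i (by omega) (j + 1) (by omega), Fin.le_def]
    omega
  · refine hA ⟨fun i => a i, fun j => b j, fun i j => ?_⟩
    rw [hR i (by omega) j (by omega), Fin.le_def]

/-! ### Trees from separated families. -/

open Classical in
/-- If the elements of `S` are pairwise separated by more than a proportion `η` of all points,
then `S` carries trees of height logarithmic in its size. -/
theorem SplitTree.of_separated {X Y : Type*} [Fintype X] {R : X → Y → Prop} {η : ℝ}
    (hη : 0 < η) (hη1 : η ≤ 1) (n : ℕ) : ∀ S : Finset Y,
    (∀ b ∈ S, ∀ c ∈ S, b ≠ c →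
      η * Fintype.card X < (Finset.univ.filter fun x => ¬ (R x b ↔ R x c)).card) →
    (4 / η) ^ n ≤ (S.card : ℝ) → SplitTree R n Set.univ (S : Set Y) := by
  have h4 : 4 ≤ 4 / η := by rw [le_div_iff₀ hη]; nlinarith
  induction n with
  | zero =>
    intro S _ hS
    have : (0 : ℝ) < S.card := by linarith [pow_zero (4 / η)]
    exact Finset.coe_nonempty.2 (Finset.card_pos.1 (by exact_mod_cast this))
  | succ n ih =>
    intro S hsep hS
    have h1 : (1 : ℝ) ≤ (4 / η) ^ n := one_le_pow₀ (by linarith)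
    have hS4 : (4 : ℝ) ≤ S.card := by
      rw [pow_succ] at hS; nlinarith
    have hlow : η * Fintype.card X * (S.card * S.card - S.card) ≤
        ∑ p ∈ S.offDiag, ((Finset.univ.filter fun x => ¬ (R x p.1 ↔ R x p.2)).card : ℝ) := by
      have := Finset.card_nsmul_le_sum S.offDiag
        (fun p => ((Finset.univ.filter fun x => ¬ (R x p.1 ↔ R x p.2)).card : ℝ))
        (η * Fintype.card X) (fun p hp => by
          rw [Finset.mem_offDiag] at hp
          exact (hsep _ hp.1 _ hp.2.1 hp.2.2).le)
      rw [nsmul_eq_mul, Finset.offDiag_card, Nat.cast_sub (Nat.le_mul_self _)] at this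
      push_cast at this
      linarith
    have hswap : ∑ p ∈ S.offDiag, ((Finset.univ.filter fun x => ¬ (R x p.1 ↔ R x p.2)).card : ℝ)
        = ∑ x : X, ((S.offDiag.filter fun p => ¬ (R x p.1 ↔ R x p.2)).card : ℝ) := by
      exact_mod_cast Finset.sum_card_bipartiteAbove_eq_sum_card_bipartiteBelow
        (s := S.offDiag) (t := Finset.univ) (fun p x => ¬ (R x p.1 ↔ R x p.2))
    have hX : 0 < Fintype.card X := by
      obtain ⟨b, hb, c, hc, hbc⟩ := Finset.one_lt_card.1
        (by exact_mod_cast (by linarith : (1 : ℝ) < S.card))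
      by_contra h0
      have h0 : Fintype.card X = 0 := by omega
      have := hsep b hb c hc hbc
      have hle := Finset.card_le_univ (Finset.univ.filter fun x => ¬ (R x b ↔ R x c))
      rw [h0, Nat.le_zero] at hle
      rw [hle, h0] at this
      simp at this
    rw [hswap] at hlow
    -- By averaging, one point `x` separates at least a proportion `η` of the ordered pairs, so
    -- neither side of its split of `S` is smaller than `η / 4 * S.card`.
    obtain ⟨x, -, hx⟩ : ∃ x ∈ (Finset.univ : Finset X), η * (S.card * S.card - S.card) ≤
        ((S.offDiag.filter fun p => ¬ (R x p.1 ↔ R x p.2)).card : ℝ) := by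
      apply Finset.exists_le_of_sum_le (Finset.card_pos.1 hX)
      rw [Finset.sum_const, nsmul_eq_mul, Finset.card_univ]
      linarith
    have hcard := Finset.card_filter_add_card_filter_not (s := S) (fun y => R x y)
    have hsub : (S.offDiag.filter fun p => ¬ (R x p.1 ↔ R x p.2)) ⊆
        (S.filter fun y => R x y) ×ˢ (S.filter fun y => ¬ R x y) ∪
        (S.filter fun y => ¬ R x y) ×ˢ (S.filter fun y => R x y) := by
      intro p hp
      simp only [Finset.mem_filter, Finset.mem_offDiag, Finset.mem_union,
        Finset.mem_product] at hp ⊢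
      tauto
    have hup := (Finset.card_le_card hsub).trans (Finset.card_union_le _ _)
    rw [Finset.card_product, Finset.card_product] at hup
    have key : ∀ p q : ℝ, 0 ≤ p → 0 ≤ q → p + q = S.card →
        η * (S.card * S.card - S.card) ≤ p * q + q * p → (4 / η) ^ n ≤ p := by
      intro p q hp hq hpq h
      have h2 : η / 4 * S.card ≤ p := by
        by_contra hlt
        push Not at hlt
        have hq' : q ≤ S.card := by linarith
        have : p * q ≤ η / 4 * S.card * S.card := by
          apply mul_le_mul hlt.le hq' hq; positivity
        have h3 : p * q < η / 4 * S.card * S.card := by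
          rcases hq.eq_or_lt with rfl | hq0
          · rw [mul_zero]; positivity
          · calc p * q < η / 4 * S.card * q := by gcongr
              _ ≤ _ := by gcongr
        nlinarith [mul_nonneg hη.le (by nlinarith : (0 : ℝ) ≤ S.card * S.card - 2 * S.card)]
      refine le_trans ?_ h2
      calc (4 / η) ^ n = η / 4 * (4 / η) ^ (n + 1) := by rw [pow_succ]; field_simp
        _ ≤ _ := by gcongr
    have hcard' : ((S.filter fun y => R x y).card : ℝ) + (S.filter fun y => ¬ R x y).card
        = S.card := by exact_mod_cast hcard
    have hx' := hx.trans (by exact_mod_cast hup :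
      ((S.offDiag.filter fun p => ¬ (R x p.1 ↔ R x p.2)).card : ℝ) ≤
        ((S.filter fun y => R x y).card : ℝ) * (S.filter fun y => ¬ R x y).card +
        (S.filter fun y => ¬ R x y).card * (S.filter fun y => R x y).card)
    refine ⟨x, Set.mem_univ _, ?_, ?_⟩
    · have := ih (S.filter fun y => R x y)
        (fun b hb c hc => hsep b (Finset.mem_of_mem_filter _ hb) c (Finset.mem_of_mem_filter _ hc))
        (key _ _ (by positivity) (by positivity) hcard' hx')
      simpa using this
    · have := ih (S.filter fun y => ¬ R x y)
        (fun b hb c hc => hsep b (Finset.mem_of_mem_filter _ hb) c (Finset.mem_of_mem_filter _ hc))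
        (key _ ((S.filter fun y => R x y).card : ℝ) (by positivity) (by positivity)
          (by rw [add_comm]; exact hcard') (by linarith))
      simpa using this

/-! ### The length function on the group and its gaps. -/

/-- The number of points whose membership in `A` changes under right multiplication by `g`. -/
noncomputable def shiftDist {G : Type*} [Group G] (A : Set G) (g : G) : ℕ :=
  {x : G | ¬ (x ∈ A ↔ x * g ∈ A)}.ncard

section ShiftDist

variable {G : Type*} [Group G] {A : Set G}

theorem shiftDist_one : shiftDist A 1 = 0 := by simp [shiftDist]

theorem ncard_mul_right_mem (S : Set G) (g : G) : {x : G | x * g ∈ S}.ncard = S.ncard := by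
  rw [← Set.ncard_image_of_injective {x : G | x * g ∈ S} (mul_left_injective g)]
  congr 1
  ext x
  simp only [Set.mem_image, Set.mem_ofPred_eq]
  exact ⟨by rintro ⟨y, hy, rfl⟩; exact hy, fun h => ⟨x * g⁻¹, by simpa using h, by simp⟩⟩

theorem shiftDist_inv (g : G) : shiftDist A g⁻¹ = shiftDist A g := by
  rw [shiftDist, ← ncard_mul_right_mem _ g, shiftDist]
  congr 1
  ext x
  simp only [Set.mem_ofPred_eq, mul_inv_cancel_right]
  tauto

theorem ncard_separating (b c : G) :
    {x : G | ¬ (x * b ∈ A ↔ x * c ∈ A)}.ncard = shiftDist A (b⁻¹ * c) := by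
  rw [shiftDist, ← ncard_mul_right_mem {x : G | ¬ (x ∈ A ↔ x * (b⁻¹ * c) ∈ A)} b]
  simp only [Set.mem_ofPred_eq, mul_assoc, mul_inv_cancel_left]

/-- Relabelling each node `x` as `x * g⁻¹` leaves every product `x * y` unchanged. -/
theorem SplitTree.image_mul_left (g : G) {n : ℕ} : ∀ {W : Set G},
    SplitTree (fun x y : G => x * y ∈ A) n Set.univ W →
    SplitTree (fun x y : G => x * y ∈ A) n Set.univ ((g * ·) '' W) := by
  induction n with
  | zero => intro W h; exact Set.Nonempty.image _ h
  | succ n ih =>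
    rintro W ⟨x, -, h1, h2⟩
    refine ⟨x * g⁻¹, Set.mem_univ _, (ih h1).mono le_rfl ?_, (ih h2).mono le_rfl ?_⟩ <;>
    · rintro _ ⟨y, ⟨hy, hxy⟩, rfl⟩
      exact ⟨⟨y, hy, rfl⟩, by simpa [mul_assoc] using hxy⟩

variable [Finite G]

theorem shiftDist_mul_le (g h : G) : shiftDist A (g * h) ≤ shiftDist A g + shiftDist A h := by
  have h1 : shiftDist A h = {x : G | ¬ (x * g ∈ A ↔ x * (g * h) ∈ A)}.ncard := by
    rw [ncard_separating, inv_mul_cancel_left]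
  rw [h1, shiftDist, shiftDist]
  refine le_trans (Set.ncard_le_ncard ?_) (Set.ncard_union_le _ _)
  intro x hx
  simp only [Set.mem_ofPred_eq, Set.mem_union] at hx ⊢
  tauto

/-- If there is no shift with distance in `(s', s]`, the shifts of distance at most `s` form a
subgroup. -/
theorem exists_subgroup_of_gap {s s' : ℝ} (hs' : 0 ≤ s') (hs : 2 * s' ≤ s)
    (hgap : ∀ g, (shiftDist A g : ℝ) ≤ s → (shiftDist A g : ℝ) ≤ s') :
    ∃ H : Subgroup G, ∀ g, g ∈ H ↔ (shiftDist A g : ℝ) ≤ s := by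
  refine ⟨{ carrier := {g | (shiftDist A g : ℝ) ≤ s}
            one_mem' := ?_, mul_mem' := ?_, inv_mem' := ?_ }, fun g => Iff.rfl⟩
  · intro a b ha hb
    have h1 := hgap a ha
    have h2 := hgap b hb
    have h3 : (shiftDist A (a * b) : ℝ) ≤ shiftDist A a + shiftDist A b := by
      exact_mod_cast shiftDist_mul_le a b
    simp only [Set.mem_ofPred_eq]
    linarith
  · simp only [Set.mem_ofPred_eq, shiftDist_one, Nat.cast_zero]
    linarith
  · intro a ha
    simpa only [Set.mem_ofPred_eq, shiftDist_inv] using ha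

/-- Shifts at `d` rapidly decreasing scales span a binary tree of height `d`. -/
theorem exists_splitTree_of_scales (d : ℕ) : ∀ (s s' : ℕ → ℝ), (∀ i, 0 ≤ s i) →
    (∀ i, 4 * s (i + 1) ≤ s' i) →
    (∀ i < d, ∃ g, s' i < shiftDist A g ∧ (shiftDist A g : ℝ) ≤ s i) →
    ∃ W : Set G, SplitTree (fun x y : G => x * y ∈ A) d Set.univ W ∧
      ({a : G | ∃ w ∈ W, ¬ (a ∈ A ↔ a * w ∈ A)}.ncard : ℝ) ≤ 2 * s 0 := by
  induction d with
  | zero =>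
    intro s s' hs _ _
    refine ⟨{1}, Set.singleton_nonempty _, ?_⟩
    simpa using hs 0
  | succ d ih =>
    intro s s' hs hss hg
    obtain ⟨W, hW, hB⟩ := ih (fun i => s (i + 1)) (fun i => s' (i + 1)) (fun i => hs _)
      (fun i => hss _) (fun i hi => hg (i + 1) (by omega))
    obtain ⟨g, hg1, hg2⟩ := hg 0 (by omega)
    set B := {a : G | ∃ w ∈ W, ¬ (a ∈ A ↔ a * w ∈ A)} with hBdef
    -- The induction bounds `B.ncard` by `2 * s 1`, so `B` and its translate together have at most
    -- `4 * s 1 ≤ s' 0` points. Hence some `a` changes membership under `g` while neither `a` nor `a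
    -- * g` is affected by `W`; this `a` is a root splitting `W` from `g * W`.
    have hlt : 2 * (B.ncard : ℝ) < shiftDist A g := by
      have := hss 0
      simp only [zero_add] at this hB
      linarith
    have hlt' : (B ∪ {x | x * g ∈ B}).ncard < shiftDist A g := by
      refine lt_of_le_of_lt (Set.ncard_union_le _ _) ?_
      rw [ncard_mul_right_mem, ← two_mul]
      exact_mod_cast hlt
    obtain ⟨a, ha, haB⟩ := Set.exists_mem_notMem_of_ncard_lt_ncard hlt'
    simp only [Set.mem_ofPred_eq] at ha
    have h1 : ∀ w ∈ W, (a * w ∈ A ↔ a ∈ A) := by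
      intro w hw
      by_contra h
      exact haB (Or.inl ⟨w, hw, fun h' => h h'.symm⟩)
    have h2 : ∀ w ∈ W, (a * (g * w) ∈ A ↔ a * g ∈ A) := by
      intro w hw
      by_contra h
      rw [← mul_assoc] at h
      exact haB (Or.inr ⟨w, hw, fun h' => h h'.symm⟩)
    refine ⟨W ∪ (g * ·) '' W, ⟨a, Set.mem_univ _, ?_⟩, ?_⟩
    · by_cases haA : a ∈ A
      · refine ⟨hW.mono le_rfl fun w hw => ⟨Or.inl hw, (h1 w hw).2 haA⟩,
          (hW.image_mul_left g).mono le_rfl ?_⟩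
        rintro _ ⟨w, hw, rfl⟩
        exact ⟨Or.inr ⟨w, hw, rfl⟩, fun h => ha ⟨fun _ => (h2 w hw).1 h, fun _ => haA⟩⟩
      · have hag : a * g ∈ A := by tauto
        refine ⟨(hW.image_mul_left g).mono le_rfl ?_,
          hW.mono le_rfl fun w hw => ⟨Or.inl hw, fun h => haA ((h1 w hw).1 h)⟩⟩
        rintro _ ⟨w, hw, rfl⟩
        exact ⟨Or.inr ⟨w, hw, rfl⟩, (h2 w hw).2 hag⟩
    · have hsub : {a : G | ∃ w ∈ W ∪ (g * ·) '' W, ¬ (a ∈ A ↔ a * w ∈ A)} ⊆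
          (B ∪ {x | x * g ∈ B}) ∪ {x : G | ¬ (x ∈ A ↔ x * g ∈ A)} := by
        rintro x ⟨_, hw | ⟨w, hw, rfl⟩, hx⟩
        · exact Or.inl (Or.inl ⟨_, hw, hx⟩)
        · by_cases hxg : x ∈ A ↔ x * g ∈ A
          · refine Or.inl (Or.inr ⟨w, hw, fun h => hx (hxg.trans ?_)⟩)
            rw [h, mul_assoc]
          · exact Or.inr hxg
      -- The old bad points and their translates number fewer than `shiftDist A g`, so the new bad
      -- set has at most `2 * shiftDist A g ≤ 2 * s 0` points.
      have h3 := (Set.ncard_le_ncard hsub).trans (Set.ncard_union_le _ _)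
      have h4 : ({a : G | ∃ w ∈ W ∪ (g * ·) '' W, ¬ (a ∈ A ↔ a * w ∈ A)}.ncard : ℝ) ≤
          shiftDist A g + shiftDist A g := by
        exact_mod_cast h3.trans (Nat.add_le_add_right hlt'.le _)
      linarith

/-- A subgroup containing every shift of distance at most `η |G|` has bounded index. -/
theorem index_le_of_shiftDist_le {η : ℝ} (hη : 0 < η) (hη1 : η ≤ 1) {d : ℕ}
    (hd : ¬ SplitTree (fun x y : G => x * y ∈ A) d Set.univ Set.univ) (H : Subgroup G)
    (hH : ∀ g, (shiftDist A g : ℝ) ≤ η * Nat.card G → g ∈ H) :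
    (H.index : ℝ) ≤ (4 / η) ^ d := by
  classical
  have := Fintype.ofFinite G
  by_contra hlt
  push Not at hlt
  -- Distinct coset representatives `b`, `c` have `b⁻¹ * c ∉ H`, so they are separated on more than
  -- `η |G|` points.
  let S : Finset G := Finset.univ.image (fun q : G ⧸ H => q.out)
  have hS : S.card = H.index := by
    rw [Finset.card_image_of_injective Finset.univ (f := fun q : G ⧸ H => q.out)
      Quotient.out_injective, Finset.card_univ,
      Subgroup.index_eq_card, Nat.card_eq_fintype_card]
  refine hd ((SplitTree.of_separated hη hη1 d S ?_ (by rw [hS]; exact hlt.le)).mono le_rfl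
    (Set.subset_univ _))
  intro b hb c hc hbc
  obtain ⟨q, -, rfl⟩ := Finset.mem_image.1 hb
  obtain ⟨r, -, rfl⟩ := Finset.mem_image.1 hc
  have hnot : q.out⁻¹ * r.out ∉ H := by
    intro hmem
    apply hbc
    have := QuotientGroup.eq.2 hmem
    rw [QuotientGroup.out_eq', QuotientGroup.out_eq'] at this
    rw [this]
  have hlt := not_le.1 (mt (hH _) hnot)
  rw [← ncard_separating, Nat.card_eq_fintype_card] at hlt
  refine hlt.trans_le (le_of_eq ?_)
  rw [← Set.ncard_coe_finset]
  simp

/-! ### Approximation by cosets. -/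

/-- The elements `x` such that `A` contains at least half of the coset `xK`. -/
def cosetMajority (A : Set G) (K : Subgroup G) : Set G :=
  {x | Nat.card K ≤ 2 * {h : G | h ∈ K ∧ x * h ∈ A}.ncard}

theorem isUnionOfCosets_cosetMajority (A : Set G) (K : Subgroup G) :
    IsUnionOfCosets K (cosetMajority A K) := by
  refine ⟨cosetMajority A K, Set.Subset.antisymm
    (fun x hx => Set.mem_biUnion hx ⟨1, K.one_mem, mul_one x⟩) ?_⟩
  intro y hy
  simp only [Set.mem_iUnion] at hy
  obtain ⟨x, hx, h, hh, rfl⟩ := hy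
  have hh : h ∈ K := hh
  simp only [cosetMajority, Set.mem_ofPred_eq, smul_eq_mul] at hx ⊢
  refine hx.trans (Nat.mul_le_mul_left 2 ?_)
  rw [← Set.ncard_image_of_injective _ (mul_right_injective h⁻¹)]
  refine Set.ncard_le_ncard ?_
  rintro _ ⟨k, ⟨hk, hxk⟩, rfl⟩
  exact ⟨K.mul_mem (K.inv_mem hh) hk, by simpa [mul_assoc] using hxk⟩

/-- If all shifts by elements of `K` have distance at most `t`, then `A` is `2t`-close to a union
of cosets of `K`. -/
theorem ncard_symmDiff_cosetMajority_le {K : Subgroup G} {t : ℝ}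
    (hK : ∀ h ∈ K, (shiftDist A h : ℝ) ≤ t) :
    ((A ∆ cosetMajority A K).ncard : ℝ) ≤ 2 * t := by
  classical
  have := Fintype.ofFinite G
  let KF : Finset G := Finset.univ.filter (· ∈ K)
  have hKF : KF.card = Nat.card K := by
    rw [← SetLike.coe_sort_coe, Nat.card_coe_set_eq, ← Set.ncard_coe_finset]
    congr 1
    ext x
    simp [KF]
  have hpos : (0 : ℝ) < Nat.card K := by exact_mod_cast Nat.card_pos
  let E : Finset G := Finset.univ.filter (· ∈ A ∆ cosetMajority A K)
  have hE : (A ∆ cosetMajority A K).ncard = E.card := by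
    rw [← Set.ncard_coe_finset]
    congr 1
    ext x
    simp [E]
  have hup : ∑ h ∈ KF, ((Finset.univ.filter fun x => ¬ (x ∈ A ↔ x * h ∈ A)).card : ℝ) ≤
      Nat.card K * t := by
    rw [← hKF, ← nsmul_eq_mul]
    refine Finset.sum_le_card_nsmul _ _ _ fun h hh => ?_
    refine le_trans (le_of_eq ?_) (hK h (by simpa [KF] using hh))
    rw [shiftDist, ← Set.ncard_coe_finset]
    simp
  have hswap : ∑ h ∈ KF, (Finset.univ.filter fun x => ¬ (x ∈ A ↔ x * h ∈ A)).card =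
      ∑ x : G, (KF.filter fun h => ¬ (x ∈ A ↔ x * h ∈ A)).card :=
    Finset.sum_card_bipartiteAbove_eq_sum_card_bipartiteBelow
      (s := KF) (t := Finset.univ) (fun h x => ¬ (x ∈ A ↔ x * h ∈ A))
  -- A point of `E` disagrees with the majority on its coset, so its membership changes under at
  -- least half of the shifts in `K`.
  have hlow : E.card * Nat.card K ≤
      2 * ∑ x : G, (KF.filter fun h => ¬ (x ∈ A ↔ x * h ∈ A)).card := by
    rw [← smul_eq_mul, Finset.mul_sum]
    refine le_trans (Finset.card_nsmul_le_sum E _ _ fun x hx => ?_)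
      (Finset.sum_le_univ_sum_of_nonneg fun _ => Nat.zero_le _)
    have hsplit := Finset.card_filter_add_card_filter_not (s := KF) (fun h => x * h ∈ A)
    have hin : {h : G | h ∈ K ∧ x * h ∈ A}.ncard = (KF.filter fun h => x * h ∈ A).card := by
      rw [← Set.ncard_coe_finset]
      congr 1
      ext h
      simp [KF]
    have hmem : x ∈ A ∆ cosetMajority A K := by simpa [E] using hx
    rw [hKF] at hsplit
    rcases hmem with ⟨hA, hD⟩ | ⟨hD, hA⟩
    · simp only [cosetMajority, Set.mem_ofPred_eq, hin, not_le] at hD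
      simp only [hA, true_iff]
      omega
    · simp only [cosetMajority, Set.mem_ofPred_eq, hin] at hD
      simp only [hA, false_iff, not_not]
      omega
  rw [hE]
  have h1 : (E.card : ℝ) * Nat.card K ≤ 2 * (Nat.card K * t) := by
    refine le_trans ?_ (mul_le_mul_of_nonneg_left hup zero_le_two)
    rw [← hswap] at hlow
    exact_mod_cast hlow
  nlinarith

end ShiftDist

/-- The core is the kernel of the action on `G ⧸ H`, so its index divides `H.index !`. -/
theorem Subgroup.index_normalCore_le {G : Type*} [Group G] [Finite G] (H : Subgroup G) :
    H.normalCore.index ≤ 2 ^ (H.index ^ 2) := by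
  have h : H.normalCore.index ∣ H.index.factorial := by
    rw [Subgroup.normalCore_eq_ker, Subgroup.index_ker, Subgroup.index_eq_card, ← Nat.card_perm]
    exact Subgroup.card_subgroup_dvd_card _
  calc H.normalCore.index ≤ H.index.factorial := Nat.le_of_dvd (Nat.factorial_pos _) h
    _ ≤ H.index ^ H.index := Nat.factorial_le_pow _
    _ ≤ (2 ^ H.index) ^ H.index := Nat.pow_le_pow_left Nat.lt_two_pow_self.le _
    _ = _ := by rw [← pow_mul, sq]

/-! ### Growth of iterated exponentials. -/

section IterExp

theorem iterExp_succ (n : ℕ) (x : ℝ) : iterExp (n + 1) x = 2 ^ iterExp n x :=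
  Function.iterate_succ_apply' _ _ _

theorem iterExp_add (m n : ℕ) (x : ℝ) : iterExp (m + n) x = iterExp m (iterExp n x) :=
  Function.iterate_add_apply _ _ _ _

theorem add_one_le_two_rpow {x : ℝ} (hx : 1 ≤ x) : x + 1 ≤ 2 ^ x := by
  have := one_add_mul_self_le_rpow_one_add (s := 1) (by norm_num) hx
  norm_num at this
  linarith

theorem add_le_iterExp {x : ℝ} (hx : 1 ≤ x) (n : ℕ) : x + n ≤ iterExp n x := by
  induction n with
  | zero => simp [iterExp]
  | succ n ih =>
    rw [iterExp_succ]
    have h0 : (0 : ℝ) ≤ n := Nat.cast_nonneg n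
    have := add_one_le_two_rpow (x := iterExp n x) (by linarith)
    push_cast
    linarith

theorem le_iterExp {x : ℝ} (hx : 1 ≤ x) (n : ℕ) : x ≤ iterExp n x := by
  have := add_le_iterExp hx n
  have h0 : (0 : ℝ) ≤ n := Nat.cast_nonneg n
  linarith

theorem one_le_iterExp_succ {x : ℝ} (hx : 0 ≤ x) (n : ℕ) : 1 ≤ iterExp (n + 1) x := by
  rw [iterExp_succ]
  refine Real.one_le_rpow one_le_two ?_
  induction n with
  | zero => exact hx
  | succ n _ => rw [iterExp_succ]; positivity

theorem iterExp_le_iterExp {x : ℝ} (hx : 1 ≤ x) {m n : ℕ} (h : m ≤ n) :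
    iterExp m x ≤ iterExp n x := by
  obtain ⟨l, rfl⟩ := Nat.exists_eq_add_of_le' h
  rw [iterExp_add]
  exact le_iterExp (hx.trans (le_iterExp hx m)) l

/-- Iterated exponentials eventually dominate a singly exponential function of a polynomial. -/
theorem mul_two_rpow_lt_iterExp (d : ℕ) {z : ℝ} (hz : 1 ≤ z) :
    8 * z * 2 ^ ((4 * z) ^ (2 * d)) < iterExp (2 * d + 7) z := by
  -- The first `2 * d + 4` iterations give only the linear bound `y ≥ z + 2 * d + 4`. Of the other
  -- three, one absorbs the product `(z + 3) * (2 * d + 1)`, one the power `(4 * z) ^ (2 * d)`, and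
  -- one the outer exponential.
  set y := iterExp (2 * d + 4) z with hy
  have hy1 : z + (2 * d + 4) ≤ y := by simpa using add_le_iterExp hz (2 * d + 4)
  have hd : (0 : ℝ) ≤ d := Nat.cast_nonneg d
  have hz2 : z ≤ 2 ^ z := by linarith [add_one_le_two_rpow hz]
  have e1 : 8 * z ≤ (2 : ℝ) ^ (z + 3) := by
    rw [Real.rpow_add two_pos]; norm_num; linarith
  have e2 : (4 * z) ^ (2 * d) ≤ (2 : ℝ) ^ ((z + 2) * (2 * d)) := by
    rw [Real.rpow_mul zero_le_two]
    have : (2 * d : ℝ) = ((2 * d : ℕ) : ℝ) := by push_cast; rfl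
    rw [this, Real.rpow_natCast]
    refine pow_le_pow_left₀ (by linarith) ?_ _
    rw [Real.rpow_add two_pos]; norm_num; linarith
  have e3 : z + 3 < (2 : ℝ) ^ (z + 3) := by linarith [add_one_le_two_rpow (x := z + 3) (by linarith)]
  have e4 : (z + 3) * (2 * d + 1) + 1 ≤ (2 : ℝ) ^ y := by
    have a1 := add_one_le_two_rpow (x := z + 2) (by linarith)
    have a2 := add_one_le_two_rpow (x := 2 * (d : ℝ) + 1) (by linarith)
    calc (z + 3) * (2 * d + 1) + 1 ≤ (z + 3) * (2 * d + 2) := by nlinarith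
      _ ≤ (2 : ℝ) ^ (z + 2) * 2 ^ (2 * (d : ℝ) + 1) := by
          apply mul_le_mul _ _ (by linarith) (by positivity) <;> linarith
      _ = 2 ^ (z + 2 + (2 * d + 1)) := by rw [← Real.rpow_add two_pos]
      _ ≤ 2 ^ y := Real.rpow_le_rpow_of_exponent_le one_le_two (by linarith)
  have e5 : z + 3 + (4 * z) ^ (2 * d) < (2 : ℝ) ^ (2 : ℝ) ^ y := by
    have b1 : (2 : ℝ) ^ (z + 3) ≤ 2 ^ ((z + 3) * (2 * d + 1)) :=
      Real.rpow_le_rpow_of_exponent_le one_le_two (by nlinarith)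
    have b2 : (2 : ℝ) ^ ((z + 2) * (2 * d)) ≤ 2 ^ ((z + 3) * (2 * d + 1)) :=
      Real.rpow_le_rpow_of_exponent_le one_le_two (by nlinarith)
    calc z + 3 + (4 * z) ^ (2 * d) < (2 : ℝ) ^ ((z + 3) * (2 * d + 1)) * 2 := by linarith
      _ = (2 : ℝ) ^ ((z + 3) * (2 * d + 1) + 1) := by rw [Real.rpow_add two_pos, Real.rpow_one]
      _ ≤ _ := Real.rpow_le_rpow_of_exponent_le one_le_two e4
  rw [show 2 * d + 7 = 2 * d + 4 + 1 + 1 + 1 by ring, iterExp_succ, iterExp_succ, iterExp_succ, ← hy]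
  calc 8 * z * 2 ^ ((4 * z) ^ (2 * d)) ≤ 2 ^ (z + 3) * 2 ^ ((4 * z) ^ (2 * d)) := by gcongr
    _ = 2 ^ (z + 3 + (4 * z) ^ (2 * d)) := by rw [← Real.rpow_add two_pos]
    _ < _ := Real.rpow_lt_rpow_of_exponent_lt one_lt_two e5

end IterExp

/-! ### Choice of scales and conclusion. -/

theorem theorem4p1 (k : ℕ) :
    ∃ N : ℕ, 1 ≤ N ∧
      ∀ (G : Type*) [Group G] [Finite G] (A : Set G), IsKStable k A →
        ∀ ε : ℝ, 0 < ε →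
          ∃ H : Subgroup G, H.Normal ∧
            (H.index : ℝ) ≤ iterExp N ε⁻¹ ∧
            ∃ D : Set G, IsUnionOfCosets H D ∧
              ((A ∆ D).ncard : ℝ) < ε * (Nat.card H : ℝ) := by
  set d := ladderHeight (k + 1) k
  set c := 2 * d + 7
  -- There are `d` windows, each costing `c` exponentials. The extra one keeps the index bound at
  -- least `1` when `ε > 1`, where `H = ⊤` works.
  refine ⟨c * d + 1, by omega, ?_⟩
  intro G _ _ A hA ε hε
  have hcard : (0 : ℝ) < Nat.card G := by exact_mod_cast Nat.card_pos
  rcases lt_or_ge 1 ε with hε1 | hε1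
  · refine ⟨⊤, inferInstance, ?_, cosetMajority A ⊤, isUnionOfCosets_cosetMajority A ⊤, ?_⟩
    · simpa using one_le_iterExp_succ (inv_nonneg.2 hε.le) (c * d)
    · have h1 : ((A ∆ cosetMajority A ⊤).ncard : ℝ) ≤ Nat.card G := by
        exact_mod_cast Set.ncard_le_card _
      rw [Subgroup.card_top]
      nlinarith
  set z := ε⁻¹
  have hz : 1 ≤ z := (one_le_inv₀ hε).2 hε1
  set Z : ℕ → ℝ := fun i => iterExp (c * i) z
  have hzZ : ∀ i, z ≤ Z i := fun i => le_iterExp hz _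
  have hZ1 : ∀ i, 1 ≤ Z i := fun i => hz.trans (hzZ i)
  have hZ0 : ∀ i, 0 < Z i := fun i => one_pos.trans_le (hZ1 i)
  have hstep : ∀ i, 8 * Z i * 2 ^ ((4 * Z i) ^ (2 * d)) < Z (i + 1) := by
    intro i
    have h := mul_two_rpow_lt_iterExp d (hZ1 i)
    rwa [← iterExp_add, show 2 * d + 7 + c * i = c * (i + 1) by ring] at h
  -- Otherwise each of the `d` windows contains a shift, giving a forbidden tree of height `d`.
  obtain ⟨i, hi, hgap⟩ : ∃ i < d, ∀ g, (shiftDist A g : ℝ) ≤ Nat.card G / Z i →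
      (shiftDist A g : ℝ) ≤ 4 * (Nat.card G / Z (i + 1)) := by
    by_contra! hno
    obtain ⟨W, hW, -⟩ := exists_splitTree_of_scales (A := A) d (fun i => Nat.card G / Z i)
      (fun i => 4 * (Nat.card G / Z (i + 1))) (fun i => div_nonneg hcard.le (hZ0 i).le)
      (fun i => le_rfl) (fun i hi => by
        obtain ⟨g, h1, h2⟩ := hno i hi
        exact ⟨g, h2, h1⟩)
    exact hA.not_splitTree (hW.mono le_rfl (Set.subset_univ _))
  have hpow : (1 : ℝ) ≤ 2 ^ ((4 * Z i) ^ (2 * d)) :=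
    Real.one_le_rpow one_le_two (pow_nonneg (by linarith [hZ0 i]) _)
  have h8 : 8 * Z i ≤ Z (i + 1) := by nlinarith [hstep i, hZ0 i]
  obtain ⟨H, hH⟩ := exists_subgroup_of_gap (A := A) (s := Nat.card G / Z i)
    (s' := 4 * (Nat.card G / Z (i + 1)))
    (mul_nonneg zero_le_four (div_nonneg hcard.le (hZ0 _).le)) (by
      rw [← mul_assoc, ← mul_div_assoc, div_le_div_iff₀ (hZ0 _) (hZ0 _)]
      nlinarith) hgap
  have hindex : (H.index : ℝ) ≤ (4 * Z i) ^ d := by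
    have h := index_le_of_shiftDist_le (A := A) (η := (Z i)⁻¹) (inv_pos.2 (hZ0 i))
      (inv_le_one_of_one_le₀ (hZ1 i)) hA.not_splitTree H
      (fun g hg => (hH g).2 (by rwa [div_eq_inv_mul]))
    rwa [div_inv_eq_mul] at h
  set K := H.normalCore
  have hK : (K.index : ℝ) ≤ 2 ^ ((4 * Z i) ^ (2 * d)) := by
    calc (K.index : ℝ) ≤ (2 : ℝ) ^ (H.index ^ 2) := by exact_mod_cast H.index_normalCore_le
      _ = (2 : ℝ) ^ ((H.index : ℝ) ^ 2) := by rw [← Real.rpow_natCast]; push_cast; rfl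
      _ ≤ 2 ^ ((4 * Z i) ^ (2 * d)) := by
        refine Real.rpow_le_rpow_of_exponent_le one_le_two ?_
        rw [mul_comm 2 d, pow_mul]
        exact pow_le_pow_left₀ (Nat.cast_nonneg _) hindex 2
  refine ⟨K, H.normalCore_normal, ?_, cosetMajority A K, isUnionOfCosets_cosetMajority A K, ?_⟩
  · calc (K.index : ℝ) ≤ 2 ^ ((4 * Z i) ^ (2 * d)) := hK
      _ ≤ Z (i + 1) := by nlinarith [hstep i, hZ1 i]
      _ ≤ iterExp (c * d + 1) z :=
        iterExp_le_iterExp hz ((Nat.mul_le_mul_left c hi).trans (Nat.le_succ _))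
  -- The gap improves the defining bound `|G| / Z i` on `H` to `4 |G| / Z (i + 1)`. The error is
  -- thus at most `8 |G| / Z (i + 1)`, and `hstep` lets `Z (i + 1)` beat `8 * z * K.index`.
  · have hclose := ncard_symmDiff_cosetMajority_le (A := A) (K := K)
      (t := 4 * (Nat.card G / Z (i + 1)))
      (fun h hh => hgap h ((hH h).1 (H.normalCore_le hh)))
    refine hclose.trans_lt ?_
    have hcardK : (Nat.card G : ℝ) = Nat.card K * K.index := by
      exact_mod_cast (K.card_mul_index).symm
    have hKpos : (0 : ℝ) < Nat.card K := by exact_mod_cast Nat.card_pos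
    have hmain : 8 * z * K.index < Z (i + 1) := by
      refine lt_of_le_of_lt ?_ (hstep i)
      have := hzZ i
      have := hZ0 i
      gcongr
    have hεz : ε * z = 1 := mul_inv_cancel₀ hε.ne'
    rw [← mul_assoc, ← mul_div_assoc, div_lt_iff₀ (hZ0 _), hcardK]
    calc 2 * 4 * ((Nat.card K : ℝ) * K.index)
        = ε * z * (8 * (Nat.card K * K.index)) := by rw [hεz]; ring
      _ = ε * Nat.card K * (8 * z * K.index) := by ring
      _ < _ := by gcongr
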